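/- Let $(X,d)$ be a proper geodesic metric space which is Gromov hyperbolic, i.e. for some $\delta>0$ every side of every geodesic triangle lies in the $\delta$-neighbourhood of the union of the other two sides. Let $\partial_G X$ be its Gromov boundary (geodesic rays $\gamma\colon[0,+\infty)\to X$ modulo the relation of staying at bounded distance from each other) and give $X\sqcup\partial_G X$ the usual topology of the Gromov compactification. For a map $f\colon X\to X$, a point $\eta\in\partial_G X$ and a base point $p\in X$, the dilation $\lambda_{\eta,p}(f)\in[0,+\infty]$ is defined by $$\log\lambda_{\eta,p}(f)=\liminf_{z\to\eta}\,\bigl(d(z,p)-d(f(z),p)\bigr)\in[-\infty,+\infty].$$ The point $\eta$ is a boundary regular fixed point (BRFP) of $f$ if $\lambda_{\eta,p}(f)<+\infty$ (a condition that does not depend on $p$) and $f$ has geodesic limit $\eta$ at $\eta$, that is, $f(x_n)\to\eta$ for every sequence $(x_n)$ in $X$ which converges to $\eta$ and is contained in a set $\{x\in X: d(x,\gamma)<R\}$ for some $R>0$ and some geodesic ray $\gamma$ with endpoint $\eta$. Let $f\colon X\to X$ be non-expanding, i.e. $d(f(x),f(y))\le d(x,y)$ for all $x,y\in X$, let $p\in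 X$, and let $\eta\in\partial_G X$ be a BRFP of $f$. Then for every $n\ge1$ the point $\eta$ is a BRFP of the iterate $f^n$. Moreover, the sequence $$\left(\frac1n\log\lambda_{\eta,p}(f^n)\right)_{n\ge1}$$ is a bounded sequence of real numbers. -/

import Mathlib

open Set Filter Topology
open scoped NNReal ENNReal

noncomputable section

namespace GromovHyp

variable {X : Type*} [MetricSpace X]

/-- `S` is the image of a geodesic joining `x` to `y`. -/
def IsGeodesicSegment (x y : X) (S : Set X) : Prop :=
  ∃ c : ℝ → X, c 0 = x ∧ c (dist x y) = y ∧
    (∀ s ∈ Icc (0 : ℝ) (dist x y), ∀ t ∈ Icc (0 : ℝ) (dist x y), dist (c s) (c t) = |s - t|) ∧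
    S = c '' Icc (0 : ℝ) (dist x y)

/-- Any two points are joined by a geodesic. -/
def IsGeodesicSpace (X : Type*) [MetricSpace X] : Prop :=
  ∀ x y : X, ∃ S : Set X, IsGeodesicSegment x y S

/-- Geodesic triangles are `δ`-thin: every side lies in the `δ`-neighbourhood of the union of the
two other sides. (The other two sides are covered by permuting the vertices cyclically.) -/
def IsDeltaHyperbolic (X : Type*) [MetricSpace X] (δ : ℝ) : Prop :=
  ∀ (x y z : X) (S₁ S₂ S₃ : Set X), IsGeodesicSegment x y S₁ → IsGeodesicSegment y z S₂ →
    IsGeodesicSegment z x S₃ → S₁ ⊆ Metric.thickening δ (S₂ ∪ S₃)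

/-- The space is `δ`-hyperbolic for some `δ > 0`. -/
def IsGromovHyperbolic (X : Type*) [MetricSpace X] : Prop :=
  ∃ δ : ℝ, 0 < δ ∧ IsDeltaHyperbolic X δ

/-- Geodesic rays: isometric embeddings of `[0, +∞)`. -/
def GeodesicRay (X : Type*) [MetricSpace X] : Type _ := {γ : ℝ≥0 → X // Isometry γ}

instance : CoeFun (GeodesicRay X) (fun _ => ℝ≥0 → X) := ⟨fun γ => γ.1⟩

/-- Two geodesic rays are asymptotic if they stay at bounded distance from each other. -/
def Asymptotic (γ σ : GeodesicRay X) : Prop := ∃ K : ℝ, ∀ t : ℝ≥0, dist (γ t) (σ t) ≤ K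

theorem asymptotic_equivalence : Equivalence (Asymptotic (X := X)) where
  refl γ := ⟨0, fun t => by simp⟩
  symm := fun ⟨K, h⟩ => ⟨K, fun t => by rw [dist_comm]; exact h t⟩
  trans := fun ⟨K, h⟩ ⟨L, h'⟩ =>
    ⟨K + L, fun t => (dist_triangle _ _ _).trans (add_le_add (h t) (h' t))⟩

/-- The setoid of asymptotic rays. -/
def asymptoticSetoid (X : Type*) [MetricSpace X] : Setoid (GeodesicRay X) :=
  ⟨Asymptotic, asymptotic_equivalence⟩

/-- The Gromov boundary `∂_G X`. -/
def GromovBoundary (X : Type*) [MetricSpace X] : Type _ := Quotient (asymptoticSetoid X)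

/-- The endpoint `[γ] ∈ ∂_G X` of a geodesic ray. -/
def GeodesicRay.endpoint (γ : GeodesicRay X) : GromovBoundary X := Quotient.mk _ γ

/-- The underlying set `X ⊔ ∂_G X` of the Gromov compactification. -/
inductive GromovCompactification (X : Type*) [MetricSpace X] : Type _
  | pt (x : X) : GromovCompactification X
  | bdry (η : GromovBoundary X) : GromovCompactification X

/-- The Gromov product `(x, y)_p`. -/
def gromovProduct (p x y : X) : ℝ := (dist x p + dist y p - dist x y) / 2

open GromovCompactification in
/-- The standard neighbourhood of a boundary point `η`: the points `ξ` of `X ⊔ ∂_G X` whose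
(extended) Gromov product with `η` based at `p` is at least `R`. -/
def bdryNhd (p : X) (η : GromovBoundary X) (R : ℝ) : Set (GromovCompactification X) :=
  {ξ | match ξ with
    | pt x => ∀ γ : GeodesicRay X, γ.endpoint = η →
        ∀ᶠ t : ℝ≥0 in atTop, R ≤ gromovProduct p x (γ t)
    | bdry ζ => ∀ γ σ : GeodesicRay X, γ.endpoint = η → σ.endpoint = ζ →
        ∀ᶠ q : ℝ≥0 × ℝ≥0 in atTop, R ≤ gromovProduct p (σ q.1) (γ q.2)}

theorem bdryNhd_anti (p : X) (η : GromovBoundary X) {R S : ℝ} (h : R ≤ S) :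
    bdryNhd p η S ⊆ bdryNhd p η R := by
  rintro (x | ζ) hx
  · exact fun γ hγ => (hx γ hγ).mono fun t ht => h.trans ht
  · exact fun γ σ hγ hσ => (hx γ σ hγ hσ).mono fun t ht => h.trans ht

open GromovCompactification in
/-- The topology of the Gromov compactification: the neighbourhoods of a point of `X` are given by
the metric balls, those of a boundary point `η` by the sets `bdryNhd p η R`. (A change of the base
point `p` changes Gromov products by a bounded amount only.) -/
instance : TopologicalSpace (GromovCompactification X) where
  IsOpen U := (∀ x : X, pt x ∈ U → ∃ ε > 0, ∀ y ∈ Metric.ball x ε, pt y ∈ U) ∧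
    ∀ η : GromovBoundary X, bdry η ∈ U → ∀ p : X, ∃ R : ℝ, bdryNhd p η R ⊆ U
  isOpen_univ := ⟨fun _ _ => ⟨1, one_pos, fun _ _ => trivial⟩,
    fun _ _ _ => ⟨0, subset_univ _⟩⟩
  isOpen_inter := by
    rintro U V ⟨hU, hU'⟩ ⟨hV, hV'⟩
    refine ⟨fun x hx => ?_, fun η hη p => ?_⟩
    · obtain ⟨ε, hε, h⟩ := hU x hx.1
      obtain ⟨ε', hε', h'⟩ := hV x hx.2
      exact ⟨min ε ε', lt_min hε hε', fun y hy =>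
        ⟨h y (Metric.ball_subset_ball (min_le_left _ _) hy),
          h' y (Metric.ball_subset_ball (min_le_right _ _) hy)⟩⟩
    · obtain ⟨R, h⟩ := hU' η hη.1 p
      obtain ⟨R', h'⟩ := hV' η hη.2 p
      exact ⟨max R R', subset_inter ((bdryNhd_anti p η (le_max_left _ _)).trans h)
        ((bdryNhd_anti p η (le_max_right _ _)).trans h')⟩
  isOpen_sUnion := by
    intro 𝒰 h𝒰
    refine ⟨fun x hx => ?_, fun η hη p => ?_⟩
    · obtain ⟨U, hU, hxU⟩ := hx
      obtain ⟨ε, hε, h⟩ := (h𝒰 U hU).1 x hxU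
      exact ⟨ε, hε, fun y hy => ⟨U, hU, h y hy⟩⟩
    · obtain ⟨U, hU, hηU⟩ := hη
      obtain ⟨R, h⟩ := (h𝒰 U hU).2 η hηU p
      exact ⟨R, h.trans (subset_sUnion_of_mem hU)⟩

/-- The filter on `X` of points `z → η` in the Gromov compactification. -/
def approach (η : GromovBoundary X) : Filter X :=
  comap GromovCompactification.pt (𝓝 (GromovCompactification.bdry η))

/-- The geodesic region `A(γ, R)`: the points at distance `< R` from the ray `γ`. -/
def geodesicRegion (γ : GeodesicRay X) (R : ℝ) : Set X := Metric.thickening R (range γ)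

/-- `g : X → Y` has geodesic limit `ξ` at `η`: for every sequence converging to `η` and contained
in a geodesic region with vertex `η`, the image sequence converges to `ξ`. -/
def HasGeodesicLimit {Y : Type*} [TopologicalSpace Y] (g : X → Y) (η : GromovBoundary X) (ξ : Y) :
    Prop :=
  ∀ x : ℕ → X, Tendsto x atTop (approach η) →
    (∃ (γ : GeodesicRay X) (R : ℝ), γ.endpoint = η ∧ 0 < R ∧ ∀ n, x n ∈ geodesicRegion γ R) →
    Tendsto (fun n => g (x n)) atTop (𝓝 ξ)

/-- The dilation `λ_{η,p}(f) ∈ [0, +∞]`, defined by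
`log λ_{η,p}(f) = liminf_{z → η} d(z, p) - d(f z, p)`. -/
def dilation (f : X → X) (η : GromovBoundary X) (p : X) : ℝ≥0∞ :=
  EReal.exp (liminf (fun z : X => ((dist z p - dist (f z) p : ℝ) : EReal)) (approach η))

/-- Finiteness of the dilation does not depend on the base point. -/
theorem dilation_lt_top_of_dilation_lt_top {f : X → X} {η : GromovBoundary X} {p q : X}
    (h : dilation f η p < ⊤) : dilation f η q < ⊤ := by
  unfold dilation at *
  rw [lt_top_iff_ne_top, Ne, EReal.exp_eq_top_iff, ← Ne, ← lt_top_iff_ne_top] at *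
  obtain ⟨M, hM, -⟩ := EReal.lt_iff_exists_real_btwn.1 h
  have h1 := frequently_lt_of_liminf_lt (by isBoundedDefault) hM
  refine lt_of_le_of_lt (liminf_le_of_frequently_le (a := ((M + 2 * dist p q : ℝ) : EReal))
    (h1.mono fun z hz => ?_)) (EReal.coe_lt_top _)
  rw [EReal.coe_lt_coe_iff] at hz
  rw [EReal.coe_le_coe_iff]
  have := dist_triangle z p q
  have := dist_triangle (f z) q p
  rw [dist_comm q p] at this
  linarith
/-- Boundary regular fixed points: the dilation is finite (a condition that does not depend on the
base point), and `f` has geodesic limit `η` at `η`. -/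
def IsBRFP (f : X → X) (η : GromovBoundary X) : Prop :=
  (∀ p : X, dilation f η p < ⊤) ∧
    HasGeodesicLimit (fun x => GromovCompactification.pt (f x)) η (GromovCompactification.bdry η)

end GromovHyp

end

/-! The key is that `f` moves a ray `γ` ending at `η` by a bounded amount `K`. Finite dilation
bounds `d(f(γ t), γ 0)` below by `t` up to a constant, so non-expansion makes the Gromov product of
`f(γ t)` and `f(γ n)` at least about `t` for `n ≥ t`. The geodesic limit puts `f(γ n)` near `η`, and
the four-point inequality then keeps `f(γ t)` close to `γ t` (`IsBRFP.exists_dist_ray_le`).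
Displacements add up under non-expanding iteration, so `f^n` moves `γ` by at most `nK`. Bounded
displacement of rays gives back a BRFP (`isBRFP_of_dist_ray_le`) and `log λ(f^n) ≤ nK`; the lower
bound `-n d(f p, p)` is the triangle inequality. -/

namespace GromovHyp

variable {X : Type*} [MetricSpace X]

/-! ### Thin triangles and the four-point inequality -/

section GeodesicSegments

theorem IsGeodesicSegment.left_mem {x y : X} {S : Set X} (h : IsGeodesicSegment x y S) :
    x ∈ S := by
  obtain ⟨c, h0, -, -, rfl⟩ := h
  exact ⟨0, ⟨le_rfl, dist_nonneg⟩, h0⟩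

theorem IsGeodesicSegment.right_mem {x y : X} {S : Set X} (h : IsGeodesicSegment x y S) :
    y ∈ S := by
  obtain ⟨c, -, h1, -, rfl⟩ := h
  exact ⟨dist x y, ⟨dist_nonneg, le_rfl⟩, h1⟩

theorem IsGeodesicSegment.dist_add_dist {x y m : X} {S : Set X} (h : IsGeodesicSegment x y S)
    (hm : m ∈ S) : dist x m + dist m y = dist x y := by
  obtain ⟨c, h0, h1, hc, rfl⟩ := h
  obtain ⟨t, ht, rfl⟩ := hm
  have h2 := hc 0 ⟨le_rfl, dist_nonneg⟩ t ht
  have h3 := hc t ht (dist x y) ⟨dist_nonneg, le_rfl⟩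
  rw [h0, zero_sub, abs_neg, abs_of_nonneg ht.1] at h2
  rw [h1, abs_sub_comm, abs_of_nonneg (sub_nonneg.2 ht.2)] at h3
  rw [h2, h3]
  ring

theorem IsGeodesicSegment.isPreconnected {x y : X} {S : Set X} (h : IsGeodesicSegment x y S) :
    IsPreconnected S := by
  obtain ⟨c, -, -, hc, rfl⟩ := h
  refine isPreconnected_Icc.image c (LipschitzOnWith.continuousOn (K := 1) ?_)
  refine LipschitzOnWith.of_dist_le_mul fun s hs t ht => ?_
  rw [hc s hs t ht, Real.dist_eq, NNReal.coe_one, one_mul]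

theorem IsGeodesicSegment.gromovProduct_le_dist {x y m : X} {S : Set X}
    (h : IsGeodesicSegment x y S) (hm : m ∈ S) (p : X) : gromovProduct p x y ≤ dist p m := by
  have h1 := h.dist_add_dist hm
  have h2 := dist_triangle x m p
  have h3 := dist_triangle y m p
  rw [dist_comm m p] at h2 h3
  rw [dist_comm y m] at h3
  unfold gromovProduct
  linarith

/-- In a thin triangle, a side comes as close to the opposite vertex as the Gromov product. -/
theorem IsDeltaHyperbolic.exists_dist_le_gromovProduct {δ : ℝ} (hgeo : IsGeodesicSpace X)
    (hδ : 0 < δ) (h : IsDeltaHyperbolic X δ) {x y : X} {S : Set X}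
    (hS : IsGeodesicSegment x y S) (p : X) :
    ∃ m ∈ S, dist p m ≤ gromovProduct p x y + 2 * δ := by
  obtain ⟨S₂, h₂⟩ := hgeo y p
  obtain ⟨S₃, h₃⟩ := hgeo p x
  have hsub := h x y p S S₂ S₃ hS h₂ h₃
  rw [Metric.thickening_union] at hsub
  -- The side is connected and covered by two open neighbourhoods, each meeting it at an endpoint;
  -- so some point is `δ`-close to both other sides.
  obtain ⟨m, hm, hm2, hm3⟩ := hS.isPreconnected _ _ Metric.isOpen_thickening
    Metric.isOpen_thickening hsub
    ⟨y, hS.right_mem, Metric.self_subset_thickening hδ _ h₂.left_mem⟩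
    ⟨x, hS.left_mem, Metric.self_subset_thickening hδ _ h₃.right_mem⟩
  refine ⟨m, hm, ?_⟩
  obtain ⟨v, hv, hmv⟩ := Metric.mem_thickening_iff.1 hm2
  obtain ⟨u, hu, hmu⟩ := Metric.mem_thickening_iff.1 hm3
  have e1 := hS.dist_add_dist hm
  have e2 := h₂.dist_add_dist hv
  have e3 := h₃.dist_add_dist hu
  have t1 := dist_triangle p u m
  have t2 := dist_triangle p v m
  have t3 := dist_triangle x u m
  have t4 := dist_triangle y v m
  rw [dist_comm u m] at t1 t3
  rw [dist_comm v m] at t2 t4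
  rw [dist_comm v p] at e2
  rw [dist_comm y m] at t4
  rw [dist_comm u x] at e3
  rw [gromovProduct, dist_comm x p]
  linarith

/-- Gromov's four point inequality with error `c`. -/
def FourPointInequality (X : Type*) [MetricSpace X] (c : ℝ) : Prop :=
  ∀ p x y z : X, min (gromovProduct p x y) (gromovProduct p y z) ≤ gromovProduct p x z + c

theorem FourPointInequality.nonneg {c : ℝ} (hc : FourPointInequality X c) (p : X) : 0 ≤ c := by
  simpa [gromovProduct] using hc p p p p

/-- The point of `[x, z]` nearly realising the Gromov product (error `2δ`) is `δ`-close to `[z, y]`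
or `[y, x]`, and the distance from `p` to a side bounds the product of its ends from above. -/
theorem IsDeltaHyperbolic.fourPointInequality {δ : ℝ} (hgeo : IsGeodesicSpace X)
    (hδ : 0 < δ) (h : IsDeltaHyperbolic X δ) : FourPointInequality X (3 * δ) := by
  intro p x y z
  obtain ⟨S₁, h₁⟩ := hgeo x z
  obtain ⟨S₂, h₂⟩ := hgeo z y
  obtain ⟨S₃, h₃⟩ := hgeo y x
  obtain ⟨m, hm, hpm⟩ := h.exists_dist_le_gromovProduct hgeo hδ h₁ p
  obtain ⟨m', hm', hd⟩ := Metric.mem_thickening_iff.1 (h x z y S₁ S₂ S₃ h₁ h₂ h₃ hm)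
  have ht := dist_triangle p m m'
  rcases hm' with hm' | hm'
  · have := h₂.gromovProduct_le_dist hm' p
    refine (min_le_right _ _).trans ?_
    simp only [gromovProduct, dist_comm z y] at *
    linarith
  · have := h₃.gromovProduct_le_dist hm' p
    refine (min_le_left _ _).trans ?_
    simp only [gromovProduct, dist_comm y x] at *
    linarith

end GeodesicSegments

/-! ### Neighbourhoods of boundary points -/

section Compactification

theorem le_gromovProduct_of_dist_le {x x' : X} {L : ℝ} (h : dist x x' ≤ L) (p y : X) :
    gromovProduct p x y - L ≤ gromovProduct p x' y := by
  have h1 := dist_triangle x x' p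
  have h2 := dist_triangle x' x y
  rw [dist_comm x' x] at h2
  unfold gromovProduct
  linarith

theorem gromovProduct_comm (p x y : X) : gromovProduct p x y = gromovProduct p y x := by
  rw [gromovProduct, gromovProduct, dist_comm x y, add_comm (dist x p)]

theorem gromovProduct_basepoint (p q x y : X) :
    gromovProduct p x y - dist p q ≤ gromovProduct q x y := by
  have h1 := dist_triangle x q p
  have h2 := dist_triangle y q p
  rw [dist_comm q p] at h1 h2
  unfold gromovProduct
  linarith

theorem bdryNhd_basepoint (p q : X) (η : GromovBoundary X) (R : ℝ) :
    bdryNhd p η (R + dist p q) ⊆ bdryNhd q η R := by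
  rintro (x | ζ) hx
  · exact fun γ hγ => (hx γ hγ).mono fun t ht => by
      linarith [gromovProduct_basepoint p q x (γ t)]
  · exact fun γ σ hγ hσ => (hx γ σ hγ hσ).mono fun t ht => by
      linarith [gromovProduct_basepoint p q (σ t.1) (γ t.2)]

theorem pt_mem_bdryNhd_of_dist_le {p x y : X} {η : GromovBoundary X} {R L : ℝ}
    (h : dist x y ≤ L) (hx : GromovCompactification.pt x ∈ bdryNhd p η (R + L)) :
    GromovCompactification.pt y ∈ bdryNhd p η R := fun γ hγ =>
  (hx γ hγ).mono fun t ht => by linarith [le_gromovProduct_of_dist_le h p (γ t)]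

theorem GromovBoundary.exists_ray (η : GromovBoundary X) : ∃ γ : GeodesicRay X, γ.endpoint = η :=
  Quotient.exists_rep η

theorem bdryNhd_subset_of_mem {p : X} {c : ℝ}
    (hc : FourPointInequality X c)
    {ζ η : GromovBoundary X} {R : ℝ}
    (hζ : GromovCompactification.bdry ζ ∈ bdryNhd p η (R + c)) :
    bdryNhd p ζ (R + c) ⊆ bdryNhd p η R := by
  obtain ⟨τ, hτ⟩ := ζ.exists_ray
  rintro (x | ξ) hx
  · intro γ hγ
    obtain ⟨q, hq⟩ := eventually_atTop.1 (hζ γ τ hγ hτ)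
    obtain ⟨s, hs⟩ := eventually_atTop.1 (hx τ hτ)
    filter_upwards [eventually_ge_atTop q.2] with t ht
    have h1 := hq (max q.1 s, t) ⟨le_max_left _ _, ht⟩
    have h2 := hs (max q.1 s) (le_max_right _ _)
    have h3 := (le_min h2 h1).trans (hc _ _ _ _)
    linarith
  · intro γ σ hγ hσ
    obtain ⟨q, hq⟩ := eventually_atTop.1 (hζ γ τ hγ hτ)
    obtain ⟨s, hs⟩ := eventually_atTop.1 (hx τ σ hτ hσ)
    filter_upwards [eventually_ge_atTop (s.1, q.2)] with t ht
    have h1 := hq (max q.1 s.2, t.2) ⟨le_max_left _ _, ht.2⟩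
    have h2 := hs (t.1, max q.1 s.2) ⟨ht.1, le_max_right _ _⟩
    have h3 := (le_min h2 h1).trans (hc _ _ _ _)
    linarith

open GromovCompactification in
theorem bdryNhd_mem_approach {p : X} {c : ℝ}
    (hc : FourPointInequality X c)
    (η : GromovBoundary X) (R : ℝ) : {x : X | pt x ∈ bdryNhd p η R} ∈ approach η := by
  -- `bdryNhd p η R` need not be open; `V` plays the role of its interior.
  let V : Set (GromovCompactification X) := {ξ | match ξ with
    | pt x => ∃ ε > 0, ∀ y ∈ Metric.ball x ε, pt y ∈ bdryNhd p η R
    | bdry ζ => ∃ T, bdryNhd p ζ T ⊆ bdryNhd p η R}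
  have hV : IsOpen V := by
    refine ⟨fun x ⟨ε, hε, hx⟩ => ⟨ε / 2, half_pos hε, fun y hy => ⟨ε / 2, half_pos hε,
      -- `T + 1` absorbs a move of length `1` in `X`, `T + c` one use of the four-point inequality,
      -- and `dist q p` the change of base point.
      fun z hz => hx z ?_⟩⟩, fun ζ ⟨T, hT⟩ q => ⟨max (T + 1) (T + c) + dist q p, ?_⟩⟩
    · rw [Metric.mem_ball] at *
      linarith [dist_triangle z y x]
    · refine (bdryNhd_basepoint q p ζ _).trans ?_
      rintro (x | ξ) hx
      · refine ⟨1, one_pos, fun y hy => hT (pt_mem_bdryNhd_of_dist_le (L := 1) ?_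
          (bdryNhd_anti p ζ (le_max_left _ _) hx))⟩
        rw [dist_comm]
        exact (Metric.mem_ball.1 hy).le
      · exact ⟨T + c, (bdryNhd_subset_of_mem hc
          (bdryNhd_anti p ζ (le_max_right _ _) hx)).trans hT⟩
  refine mem_comap.2 ⟨V, hV.mem_nhds ⟨R, Subset.rfl⟩, ?_⟩
  rintro x ⟨ε, hε, hx⟩
  exact hx x (Metric.mem_ball_self hε)

/-- Convergence to a boundary point in terms of the standard neighbourhoods. -/
theorem tendsto_approach_of_eventually_bdryNhd {ι : Type*} {l : Filter ι} {u : ι → X}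
    {η : GromovBoundary X} (p : X)
    (h : ∀ R, ∀ᶠ k in l, GromovCompactification.pt (u k) ∈ bdryNhd p η R) :
    Tendsto u l (approach η) := by
  refine tendsto_comap_iff.2 fun U hU => ?_
  obtain ⟨V, hVU, hV, hη⟩ := mem_nhds_iff.1 hU
  obtain ⟨R, hR⟩ := hV.2 η hη p
  exact (h R).mono fun k hk => hVU (hR hk)

theorem tendsto_approach_of_dist_le (p : X) {c : ℝ}
    (hc : FourPointInequality X c)
    {ι : Type*} {l : Filter ι} {u v : ι → X} {η : GromovBoundary X} {L : ℝ}
    (hu : Tendsto u l (approach η)) (h : ∀ k, dist (u k) (v k) ≤ L) :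
    Tendsto v l (approach η) :=
  tendsto_approach_of_eventually_bdryNhd p fun R =>
    (hu.eventually (bdryNhd_mem_approach (p := p) hc η (R + L))).mono fun k hk => pt_mem_bdryNhd_of_dist_le (h k) hk

end Compactification

/-! ### Convergence along geodesic rays -/

section Rays

theorem GeodesicRay.dist_eq (γ : GeodesicRay X) {s t : ℝ≥0} (h : s ≤ t) :
    dist (γ s) (γ t) = t - s := by
  rw [γ.2.dist_eq, dist_comm, NNReal.dist_eq, abs_of_nonneg (sub_nonneg.2 (by exact_mod_cast h))]

theorem GeodesicRay.gromovProduct_eq (γ : GeodesicRay X) {s t : ℝ≥0} (h : s ≤ t) :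
    gromovProduct (γ 0) (γ t) (γ s) = s := by
  have h1 := γ.dist_eq (zero_le (a := t))
  have h2 := γ.dist_eq (zero_le (a := s))
  have h3 := γ.dist_eq h
  rw [NNReal.coe_zero] at h1 h2
  rw [gromovProduct, dist_comm _ (γ 0), dist_comm _ (γ 0), dist_comm (γ t), h1, h2, h3]
  ring

/-- A geodesic ray converges to its endpoint. -/
theorem GeodesicRay.tendsto_approach (γ : GeodesicRay X) {c : ℝ} (hc : FourPointInequality X c) :
    Tendsto γ.1 atTop (approach γ.endpoint) := by
  refine tendsto_approach_of_eventually_bdryNhd (γ 0) fun R => ?_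
  obtain ⟨T, hT⟩ := exists_nat_ge (R + c)
  filter_upwards [eventually_ge_atTop (T : ℝ≥0)] with t ht σ hσ
  obtain ⟨K, hK⟩ : Asymptotic σ γ := Quotient.exact hσ
  -- Replacing `γ s` by `σ s` costs at most `K` in the Gromov product, which therefore stays above
  -- `t` once `s ≥ t + K`.
  obtain ⟨S, hS⟩ := exists_nat_ge (t + K)
  filter_upwards [eventually_ge_atTop (S : ℝ≥0), eventually_ge_atTop t] with s hs hts
  have ht' : (T : ℝ) ≤ t := by exact_mod_cast ht
  have hs' : (S : ℝ) ≤ s := by exact_mod_cast hs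
  have h1 : (t : ℝ) ≤ gromovProduct (γ 0) (γ t) (γ s) := by
    rw [gromovProduct_comm, γ.gromovProduct_eq hts]
  have h2 : (t : ℝ) ≤ gromovProduct (γ 0) (γ s) (σ s) := by
    have e1 := le_gromovProduct_of_dist_le ((dist_comm _ _).trans_le (hK s)) (γ 0) (γ s)
    rw [γ.gromovProduct_eq le_rfl, gromovProduct_comm] at e1
    linarith
  have h3 := (le_min h1 h2).trans (hc _ _ _ _)
  linarith

end Rays

/-! ### Non-expanding maps near a boundary fixed point -/

section Dynamics

variable {f : X → X} {η : GromovBoundary X}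

/-- A non-expanding map displaces a geodesic ray ending at a boundary regular fixed point by a
bounded amount. -/
theorem IsBRFP.exists_dist_ray_le (hη : IsBRFP f η) (hf : ∀ x y : X, dist (f x) (f y) ≤ dist x y)
    {γ : GeodesicRay X} (hγ : γ.endpoint = η) {c : ℝ}
    (hc : FourPointInequality X c) :
    ∃ K : ℝ, ∀ t : ℝ≥0, dist (f (γ t)) (γ t) ≤ K := by
  have hdil := hη.1 (γ 0)
  unfold dilation at hdil
  rw [lt_top_iff_ne_top, Ne, EReal.exp_eq_top_iff, ← Ne, ← lt_top_iff_ne_top] at hdil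
  obtain ⟨M, hM, -⟩ := EReal.lt_iff_exists_real_btwn.1 hdil
  have hfreq := frequently_lt_of_liminf_lt (by isBoundedDefault) hM
  -- For `z` near `η` the product with `γ t` is at least `t - c`, so `d(z, γ t) ≤ d(z, γ 0) - t +
  -- 2c`; compare `f z` with `f (γ t)`.
  have hlow : ∀ t : ℝ≥0, t - M - 2 * c ≤ dist (f (γ t)) (γ 0) := by
    intro t
    obtain ⟨z, hz, hzt⟩ := (hfreq.and_eventually (bdryNhd_mem_approach (p := γ 0) hc η t)).exists
    rw [EReal.coe_lt_coe_iff] at hz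
    obtain ⟨s, hs, hts⟩ := ((hzt γ hγ).and (eventually_ge_atTop t)).exists
    have h1 := (le_min hs (γ.gromovProduct_eq hts).ge).trans (hc _ _ _ _)
    have h2 := γ.dist_eq (zero_le (a := t))
    rw [NNReal.coe_zero, dist_comm] at h2
    rw [gromovProduct, h2] at h1
    have h3 := dist_triangle (f z) (f (γ t)) (γ 0)
    have h4 := hf z (γ t)
    linarith
  have hlim : Tendsto (fun n : ℕ => f (γ n)) atTop (approach η) := by
    refine tendsto_comap_iff.2 (hη.2 (fun n : ℕ => γ n) ?_ ⟨γ, 1, hγ, one_pos, fun n => ?_⟩)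
    · exact (hγ ▸ γ.tendsto_approach hc).comp tendsto_natCast_atTop_atTop
    · exact Metric.self_subset_thickening one_pos _ (mem_range_self _)
  refine ⟨dist (f (γ 0)) (γ 0) + 2 * |M| + 6 * c, fun t => ?_⟩
  obtain ⟨n, hn, htn⟩ := ((hlim.eventually (bdryNhd_mem_approach (p := γ 0) hc η t)).and
    ((tendsto_natCast_atTop_atTop (R := ℝ≥0)).eventually_ge_atTop t)).exists
  obtain ⟨s, hs, hts⟩ := ((hn γ hγ).and (eventually_ge_atTop t)).exists
  have h1 := (le_min hs (γ.gromovProduct_eq hts).ge).trans (hc _ _ _ _)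
  -- Average `hlow` at `t` and at `n`, using that `f` does not stretch the length `n - t`.
  have h2 : t - M - 2 * c ≤ gromovProduct (γ 0) (f (γ t)) (f (γ n)) := by
    have e1 := hlow t
    have e2 := hlow n
    have e3 := hf (γ t) (γ n)
    rw [γ.dist_eq htn] at e3
    unfold gromovProduct
    linarith
  have h3 := hc (γ 0) (f (γ t)) (f (γ n)) (γ t)
  have h4 := γ.dist_eq (zero_le (a := t))
  rw [NNReal.coe_zero, dist_comm] at h4
  have h5 := dist_triangle (f (γ t)) (f (γ 0)) (γ 0)
  have h6 := hf (γ t) (γ 0)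
  rw [h4] at h6
  have h7 : t - |M| - 2 * c ≤
      min (gromovProduct (γ 0) (f (γ t)) (f (γ n))) (gromovProduct (γ 0) (f (γ n)) (γ t)) :=
    le_min (by linarith [le_abs_self M]) (by linarith [abs_nonneg M, hc.nonneg (γ 0)])
  have h8 := h7.trans h3
  rw [gromovProduct, h4] at h8
  linarith

theorem dist_iterate_le_nat_mul (hf : ∀ x y : X, dist (f x) (f y) ≤ dist x y) {x : X} {K : ℝ}
    (h : dist (f x) x ≤ K) (n : ℕ) : dist (f^[n] x) x ≤ n * K := by
  induction n with
  | zero => simp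
  | succ n ih =>
    rw [Function.iterate_succ_apply']
    have h1 := dist_triangle (f (f^[n] x)) (f x) x
    have h2 := hf (f^[n] x) x
    push_cast
    linarith

theorem dist_iterate_le (hf : ∀ x y : X, dist (f x) (f y) ≤ dist x y) (n : ℕ) (x y : X) :
    dist (f^[n] x) (f^[n] y) ≤ dist x y := by
  induction n with
  | zero => simp
  | succ n ih =>
    rw [Function.iterate_succ_apply', Function.iterate_succ_apply']
    exact (hf _ _).trans ih

theorem log_dilation (f : X → X) (η : GromovBoundary X) (p : X) :
    ENNReal.log (dilation f η p) =
      liminf (fun z : X => ((dist z p - dist (f z) p : ℝ) : EReal)) (approach η) := by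
  rw [dilation, EReal.log_exp]

theorem neg_dist_le_log_dilation (hf : ∀ x y : X, dist (f x) (f y) ≤ dist x y)
    (η : GromovBoundary X) (p : X) :
    ((-dist (f p) p : ℝ) : EReal) ≤ ENNReal.log (dilation f η p) := by
  rw [log_dilation]
  refine le_liminf_of_le (by isBoundedDefault) (Eventually.of_forall fun z => ?_)
  rw [EReal.coe_le_coe_iff]
  linarith [dist_triangle (f z) (f p) p, hf z p]

/-- The ray itself tends to `η`, so values along it bound the liminf from above. -/
theorem log_dilation_le_of_dist_ray_le {c : ℝ} (hc : FourPointInequality X c)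
    {γ : GeodesicRay X} (hγ : γ.endpoint = η) {K : ℝ} (hK : ∀ t : ℝ≥0, dist (f (γ t)) (γ t) ≤ K) (p : X) :
    ENNReal.log (dilation f η p) ≤ (K : EReal) := by
  rw [log_dilation]
  refine liminf_le_of_frequently_le ?_ (by isBoundedDefault)
  have hfr : ∃ᶠ t in (atTop : Filter ℝ≥0),
      ((dist (γ t) p - dist (f (γ t)) p : ℝ) : EReal) ≤ K := by
    refine (Eventually.of_forall fun t => ?_).frequently
    rw [EReal.coe_le_coe_iff]
    have := dist_triangle (γ t) (f (γ t)) p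
    rw [dist_comm (γ t) (f (γ t))] at this
    linarith [hK t]
  exact (hγ ▸ γ.tendsto_approach hc).frequently hfr

/-- A non-expanding map which displaces every ray ending at `η` by a bounded amount has `η` as a
boundary regular fixed point. -/
theorem isBRFP_of_dist_ray_le {c : ℝ}
    (hc : FourPointInequality X c)
    (hf : ∀ x y : X, dist (f x) (f y) ≤ dist x y)
    (h : ∀ γ : GeodesicRay X, γ.endpoint = η → ∃ K : ℝ, ∀ t : ℝ≥0, dist (f (γ t)) (γ t) ≤ K) :
    IsBRFP f η := by
  refine ⟨fun q => ?_, fun x hx ⟨γ, R, hγ, hR, hxγ⟩ => ?_⟩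
  · obtain ⟨γ, hγ⟩ := η.exists_ray
    obtain ⟨K, hK⟩ := h γ hγ
    rw [lt_top_iff_ne_top, Ne, ← ENNReal.log_eq_top_iff]
    exact ((log_dilation_le_of_dist_ray_le hc hγ hK q).trans_lt (EReal.coe_lt_top K)).ne
  · obtain ⟨K, hK⟩ := h γ hγ
    -- `2 * R + K` is the length of the path `x n`, `γ t`, `f (γ t)`, `f (x n)`.
    refine tendsto_comap_iff.1 (tendsto_approach_of_dist_le (x 0) hc (L := 2 * R + K) hx fun n => ?_)
    obtain ⟨_, ⟨t, rfl⟩, ht⟩ := Metric.mem_thickening_iff.1 (hxγ n)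
    have h1 := dist_triangle4 (x n) (γ t) (f (γ t)) (f (x n))
    have h2 := hf (γ t) (x n)
    rw [dist_comm (γ t) (x n)] at h2
    rw [dist_comm (γ t) (f (γ t))] at h1
    linarith [hK t]

end Dynamics

end GromovHyp

open GromovHyp in
theorem mainTheorem4 {X : Type*} [MetricSpace X] [ProperSpace X]
    (hgeo : GromovHyp.IsGeodesicSpace X) (hhyp : GromovHyp.IsGromovHyperbolic X)
    (f : X → X) (hf : ∀ x y : X, dist (f x) (f y) ≤ dist x y)
    (p : X) (η : GromovHyp.GromovBoundary X) (hη : GromovHyp.IsBRFP f η) :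
    (∀ n : ℕ, 1 ≤ n → GromovHyp.IsBRFP (f^[n]) η) ∧
    ∃ C : ℝ, ∀ n : ℕ, 1 ≤ n →
      ((-C : ℝ) : EReal) ≤ ENNReal.log (GromovHyp.dilation (f^[n]) η p) / (n : EReal) ∧
      ENNReal.log (GromovHyp.dilation (f^[n]) η p) / (n : EReal) ≤ (C : EReal) := by
  obtain ⟨δ, hδ, hhyp⟩ := hhyp
  have hc := hhyp.fourPointInequality hgeo hδ
  have hray : ∀ γ : GeodesicRay X, γ.endpoint = η →
      ∃ K : ℝ, ∀ (n : ℕ) (t : ℝ≥0), dist (f^[n] (γ t)) (γ t) ≤ n * K := fun γ hγ => by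
    obtain ⟨K, hK⟩ := hη.exists_dist_ray_le hf hγ hc
    exact ⟨K, fun n t => dist_iterate_le_nat_mul hf (hK t) n⟩
  refine ⟨fun n _ => isBRFP_of_dist_ray_le hc (dist_iterate_le hf n) fun γ hγ => ?_, ?_⟩
  · obtain ⟨K, hK⟩ := hray γ hγ
    exact ⟨n * K, hK n⟩
  obtain ⟨γ, hγ⟩ := η.exists_ray
  obtain ⟨K, hK⟩ := hray γ hγ
  -- `K` serves the upper bound, `dist (f p) p` the lower one.
  refine ⟨max K (dist (f p) p), fun n hn => ?_⟩
  have hn0 : (0 : ℝ) < n := by exact_mod_cast hn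
  have hn0' : (0 : EReal) < (n : EReal) := by exact_mod_cast hn
  have hntop : (n : EReal) ≠ ⊤ := EReal.natCast_ne_top n
  constructor
  · rw [EReal.le_div_iff_mul_le hn0' hntop]
    refine le_trans ?_ (neg_dist_le_log_dilation (dist_iterate_le hf n) η p)
    rw [← EReal.coe_natCast, ← EReal.coe_mul, EReal.coe_le_coe_iff]
    have h1 := dist_iterate_le_nat_mul hf (le_max_right K (dist (f p) p)) n
    linarith
  · rw [EReal.div_le_iff_le_mul hn0' hntop]
    refine (log_dilation_le_of_dist_ray_le hc hγ (hK n) p).trans ?_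
    rw [← EReal.coe_natCast, ← EReal.coe_mul, EReal.coe_le_coe_iff]
    gcongr
    exact le_max_left _ _
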